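/- Let $G$ be a connected simple graph on $n$ vertices with diameter $d$. Let $Q(G)$ be its signless Laplacian matrix, that is, the sum of the diagonal matrix of vertex degrees and the adjacency matrix of $G$, and for an interval $I$ of real numbers let $m_G I$ denote the number of eigenvalues of $Q(G)$, counted with multiplicity, that lie in $I$ (with $[a,b)=\emptyset$ if $b\le a$). Then \[ m_G[0,n-2)\ge d-1 . \] Moreover, if $3\le d\le n-3$, then \[ m_G[0,n-d+1)\ge \begin{cases} d & \text{if } 3\le d\le n-5,\\ d-1 & \text{if } d\in\{n-4,\,n-3\}. \end{cases} \] -/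

import Mathlib

noncomputable section

namespace SimpleGraph

variable {V : Type*} [Fintype V] [DecidableEq V]

/-- The signless Laplacian matrix `Q(G)`: the sum of the diagonal matrix of vertex degrees and
the adjacency matrix, over the reals. -/
def signlessLapMatrix (G : SimpleGraph V) [DecidableRel G.Adj] : Matrix V V ℝ :=
  G.degMatrix ℝ + G.adjMatrix ℝ

theorem isHermitian_signlessLapMatrix (G : SimpleGraph V) [DecidableRel G.Adj] :
    G.signlessLapMatrix.IsHermitian :=
  (G.isHermitian_degMatrix ℝ).add (G.isHermitian_adjMatrix ℝ)

open Classical in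
/-- The number `m_G I` of signless Laplacian eigenvalues of `G`, counted with multiplicity,
that lie in the set `I` of reals. -/
def signlessLapEigenvalueCount (G : SimpleGraph V) [DecidableRel G.Adj] (I : Set ℝ) : ℕ :=
  (Finset.univ.filter fun v : V => G.isHermitian_signlessLapMatrix.eigenvalues v ∈ I).card

end SimpleGraph

end

/-! ### Eigenvalue counts from quadratic form bounds -/

open Finset Matrix

/-! By Courant–Fischer, if the form of Q is at most a‖x‖² on a subspace of codimension k, with
equality at no nonzero a-eigenvector, then at least n - k eigenvalues lie below a, hence in [0, a)
since Q is positive semidefinite.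

Take a geodesic f 0, …, f d realising the diameter, with m = n - d - 1 vertices off it, so n - d + 1
= m + 2. On vectors supported on the path, off-path neighbours only raise degrees. Each edge term 2
y_j y_{j+1} is shared between its ends, and each extra condition (y_k = 0 or y_p + y_{p+1} = 0)
costs one of d + 1 dimensions. Path vertices at least three apart have no common neighbour, so for m
≥ 3 those with more than m - 2 off-path neighbours sit in a window i - 1, i, i + 1, and two
conditions suffice. For m ≥ 4 one suffices, unless f (i - 1) and f (i + 1) both see every off-path
vertex; `card_le_count_add_three` then uses test vectors on the whole graph. The threshold n - 2
exceeds m + 2 by d - 3, so only small d needs extra conditions there. -/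

theorem Matrix.IsHermitian.card_le_card_eigenvalues_lt_add {V ι : Type*} [Fintype V]
    [DecidableEq V] [Fintype ι] {A : Matrix V V ℝ} (hA : A.IsHermitian)
    (φ : ι → Module.Dual ℝ (V → ℝ)) (a : ℝ)
    (hle : ∀ x : V → ℝ, (∀ i, φ i x = 0) → x ⬝ᵥ A *ᵥ x ≤ a * (x ⬝ᵥ x))
    (heq : ∀ x : V → ℝ, (∀ i, φ i x = 0) → x ⬝ᵥ A *ᵥ x = a * (x ⬝ᵥ x) →
      A *ᵥ x = a • x → x = 0) :
    Fintype.card V ≤ (univ.filter fun v => hA.eigenvalues v < a).card + Fintype.card ι := by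
  classical
  set b : V → V → ℝ := fun v => (hA.eigenvectorBasis v : V → ℝ) with hb
  have expand : ∀ x : V → ℝ, x = ∑ v, (b v ⬝ᵥ x) • b v := by
    intro x
    have h := hA.eigenvectorBasis.sum_repr' (WithLp.toLp 2 x)
    have h' := congrArg WithLp.ofLp h
    simp only [WithLp.ofLp_sum, WithLp.ofLp_smul] at h'
    refine h'.symm.trans (Finset.sum_congr rfl fun v _ => ?_)
    rw [EuclideanSpace.inner_eq_star_dotProduct, star_trivial, dotProduct_comm]
  have eig : ∀ v, A *ᵥ b v = hA.eigenvalues v • b v := fun v => hA.mulVec_eigenvectorBasis v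
  let S := {v : V // hA.eigenvalues v < a}
  let T : (V → ℝ) →ₗ[ℝ] (ι ⊕ S → ℝ) :=
    LinearMap.pi (Sum.elim φ fun v => dotProductBilin ℝ ℝ (b v))
  -- A kernel vector has no component along eigenvalues below a, so its form is at least a‖x‖². With
  -- `hle` equality holds term by term, making x an a-eigenvector.
  have hT : Function.Injective T := by
    rw [← LinearMap.ker_eq_bot, LinearMap.ker_eq_bot']
    intro x hx
    have hφ : ∀ i, φ i x = 0 := fun i => congrFun hx (Sum.inl i)
    have hS : ∀ v, hA.eigenvalues v < a → b v ⬝ᵥ x = 0 := fun v hv =>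
      congrFun hx (Sum.inr ⟨v, hv⟩)
    have hAx : A *ᵥ x = ∑ v, (b v ⬝ᵥ x) • hA.eigenvalues v • b v := by
      conv_lhs => rw [expand x]
      rw [mulVec_sum]
      simp_rw [mulVec_smul, eig]
    have h1 : x ⬝ᵥ A *ᵥ x = ∑ v, hA.eigenvalues v * (b v ⬝ᵥ x) ^ 2 := by
      rw [hAx, dotProduct_sum]
      refine Finset.sum_congr rfl fun v _ => ?_
      rw [dotProduct_smul, dotProduct_smul, dotProduct_comm x]
      simp only [smul_eq_mul]; ring
    have h2 : a * (x ⬝ᵥ x) = ∑ v, a * (b v ⬝ᵥ x) ^ 2 := by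
      conv_lhs => arg 2; arg 2; rw [expand x]
      rw [dotProduct_sum, Finset.mul_sum]
      refine Finset.sum_congr rfl fun v _ => ?_
      rw [dotProduct_smul, dotProduct_comm x]
      simp only [smul_eq_mul]; ring
    have h3 : ∀ v ∈ (univ : Finset V),
        a * (b v ⬝ᵥ x) ^ 2 ≤ hA.eigenvalues v * (b v ⬝ᵥ x) ^ 2 := by
      intro v _
      rcases lt_or_ge (hA.eigenvalues v) a with h | h
      · simp [hS v h]
      · exact mul_le_mul_of_nonneg_right h (sq_nonneg _)
    have h4 : x ⬝ᵥ A *ᵥ x = a * (x ⬝ᵥ x) := by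
      refine le_antisymm (hle x hφ) ?_
      rw [h1, h2]
      exact Finset.sum_le_sum h3
    refine heq x hφ h4 ?_
    have h5 := (Finset.sum_eq_sum_iff_of_le h3).1 (by rw [← h1, ← h2, h4])
    rw [hAx]
    conv_rhs => rw [expand x, Finset.smul_sum]
    refine Finset.sum_congr rfl fun v hv => ?_
    have h6 := h5 v hv
    rw [smul_comm, ← smul_assoc, ← smul_assoc, smul_eq_mul, smul_eq_mul]
    rcases eq_or_ne (b v ⬝ᵥ x) 0 with h0 | h0
    · simp [h0]
    · rw [mul_right_cancel₀ (pow_ne_zero 2 h0) h6]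
  have := LinearMap.finrank_le_finrank_of_injective hT
  simp only [Module.finrank_fintype_fun_eq_card, Fintype.card_sum] at this
  have hS : Fintype.card S = (univ.filter fun v => hA.eigenvalues v < a).card :=
    Fintype.card_subtype _
  omega

/-! ### The quadratic form of the signless Laplacian -/

namespace SimpleGraph

variable {V : Type*} [Fintype V] [DecidableEq V] (G : SimpleGraph V) [DecidableRel G.Adj]

theorem signlessLapMatrix_mulVec_apply (x : V → ℝ) (v : V) :
    (G.signlessLapMatrix *ᵥ x) v = G.degree v * x v + ∑ u, if G.Adj v u then x u else 0 := by
  rw [signlessLapMatrix, add_mulVec, Pi.add_apply, degMatrix, mulVec_diagonal,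
    adjMatrix_mulVec_apply, ← Finset.sum_filter, neighborFinset_eq_filter]

theorem two_mul_dotProduct_signlessLapMatrix_mulVec (x : V → ℝ) :
    2 * (x ⬝ᵥ G.signlessLapMatrix *ᵥ x) =
      ∑ v, ∑ u, if G.Adj v u then (x v + x u) ^ 2 else 0 := by
  have h1 : ∀ v, (G.degree v : ℝ) * x v ^ 2 = ∑ u, if G.Adj v u then x v ^ 2 else 0 := by
    intro v
    rw [← Finset.sum_filter, Finset.sum_const, ← neighborFinset_eq_filter,
      card_neighborFinset_eq_degree, nsmul_eq_mul]
  have h2 : ∑ v, ∑ u, (if G.Adj v u then x u ^ 2 else 0) = ∑ v, (G.degree v : ℝ) * x v ^ 2 := by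
    rw [Finset.sum_comm]
    refine Finset.sum_congr rfl fun v _ => ?_
    rw [h1]
    simp_rw [G.adj_comm]
  have h3 : x ⬝ᵥ G.signlessLapMatrix *ᵥ x = ∑ v, (G.degree v : ℝ) * x v ^ 2
      + ∑ v, ∑ u, if G.Adj v u then x v * x u else 0 := by
    rw [dotProduct, ← Finset.sum_add_distrib]
    refine Finset.sum_congr rfl fun v _ => ?_
    rw [signlessLapMatrix_mulVec_apply, mul_add, Finset.mul_sum]
    congr 1
    · ring
    · simp
  have h4 : ∑ v, ∑ u, (if G.Adj v u then (x v + x u) ^ 2 else 0) =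
      ∑ v, ∑ u, (if G.Adj v u then x v ^ 2 else 0) + ∑ v, ∑ u, (if G.Adj v u then x u ^ 2 else 0)
      + 2 * ∑ v, ∑ u, if G.Adj v u then x v * x u else 0 := by
    simp_rw [Finset.mul_sum, ← Finset.sum_add_distrib]
    refine Finset.sum_congr rfl fun v _ => Finset.sum_congr rfl fun u _ => ?_
    split_ifs <;> ring
  rw [h4, h2, h3]
  simp_rw [← h1]
  ring

theorem posSemidef_signlessLapMatrix : G.signlessLapMatrix.PosSemidef := by
  refine Matrix.PosSemidef.of_dotProduct_mulVec_nonneg G.isHermitian_signlessLapMatrix fun x => ?_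
  have h := G.two_mul_dotProduct_signlessLapMatrix_mulVec x
  have : 0 ≤ ∑ v, ∑ u, if G.Adj v u then (x v + x u) ^ 2 else 0 :=
    Finset.sum_nonneg fun v _ => Finset.sum_nonneg fun u _ => by positivity
  simp only [star_trivial]
  linarith

theorem card_le_signlessLapEigenvalueCount_add {ι : Type*} [Fintype ι]
    (φ : ι → Module.Dual ℝ (V → ℝ)) (a : ℝ)
    (hle : ∀ x : V → ℝ, (∀ i, φ i x = 0) →
      x ⬝ᵥ G.signlessLapMatrix *ᵥ x ≤ a * (x ⬝ᵥ x))
    (heq : ∀ x : V → ℝ, (∀ i, φ i x = 0) → x ⬝ᵥ G.signlessLapMatrix *ᵥ x = a * (x ⬝ᵥ x) →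
      G.signlessLapMatrix *ᵥ x = a • x → x = 0) :
    Fintype.card V ≤ G.signlessLapEigenvalueCount (Set.Ico 0 a) + Fintype.card ι := by
  have h := G.isHermitian_signlessLapMatrix.card_le_card_eigenvalues_lt_add φ a hle heq
  rw [signlessLapEigenvalueCount]
  convert h using 3
  ext v
  simp only [Set.mem_Ico, Finset.mem_filter, Finset.mem_univ, true_and, and_iff_right_iff_imp]
  exact fun _ => G.posSemidef_signlessLapMatrix.eigenvalues_nonneg v

end SimpleGraph

/-! ### Geodesics and vectors supported on them -/

namespace SimpleGraph

/-- The vertices `f 0, …, f d` form a shortest path of `G`. -/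
def IsGeodesicSeq {V : Type*} (G : SimpleGraph V) (f : ℕ → V) (d : ℕ) : Prop :=
  ∀ i j, i ≤ j → j ≤ d → G.dist (f i) (f j) = j - i

theorem Connected.exists_isGeodesicSeq_diam {V : Type*} [Finite V] {G : SimpleGraph V}
    (hG : G.Connected) : ∃ f : ℕ → V, G.IsGeodesicSeq f G.diam := by
  have := hG.nonempty
  obtain ⟨u, v, huv⟩ := G.exists_dist_eq_diam
  obtain ⟨p, hp⟩ := hG.exists_walk_length_eq_dist u v
  refine ⟨p.getVert, fun i j hij hj => ?_⟩
  have hlen : p.length = G.diam := hp.trans huv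
  have h1 : G.dist u (p.getVert i) ≤ i := (dist_le (p.take i)).trans (by simp)
  have h2 : G.dist (p.getVert j) v ≤ p.length - j := (dist_le (p.drop j)).trans (by simp)
  have h3 : G.dist (p.getVert i) (p.getVert j) ≤ j - i := by
    have e : (p.drop i).getVert (j - i) = p.getVert j := by
      rw [Walk.drop_getVert]; congr 1; omega
    rw [← e]
    exact (dist_le ((p.drop i).take (j - i))).trans (by simp)
  have h4 := hG.dist_triangle (u := u) (v := p.getVert i) (w := v)
  have h5 := hG.dist_triangle (u := p.getVert i) (v := p.getVert j) (w := v)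
  omega

/-- The vertices outside `f 0, …, f d`. -/
def offPath {V : Type*} [Fintype V] [DecidableEq V] (f : ℕ → V) (d : ℕ) : Finset V :=
  univ \ (range (d + 1)).image f

/-- The neighbours of `v` outside `f 0, …, f d`. -/
def offNeighbors {V : Type*} [Fintype V] [DecidableEq V] (G : SimpleGraph V) [DecidableRel G.Adj]
    (f : ℕ → V) (d : ℕ) (v : V) : Finset V :=
  (offPath f d).filter (G.Adj v)

namespace IsGeodesicSeq

variable {V : Type*} {G : SimpleGraph V} {f : ℕ → V} {d : ℕ}

theorem eq_of_apply_eq (h : G.IsGeodesicSeq f d) {i j : ℕ} (hi : i ≤ d) (hj : j ≤ d)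
    (hij : f i = f j) : i = j := by
  rcases le_total i j with hle | hle
  · have := h i j hle hj
    rw [hij, dist_self] at this
    omega
  · have := h j i hle hi
    rw [hij, dist_self] at this
    omega

theorem adj_iff (h : G.IsGeodesicSeq f d) {i j : ℕ} (hi : i ≤ d) (hj : j ≤ d) :
    G.Adj (f i) (f j) ↔ j = i + 1 ∨ i = j + 1 := by
  rw [← dist_eq_one_iff_adj]
  rcases le_total i j with hle | hle
  · rw [h i j hle hj]; omega
  · rw [dist_comm, h j i hle hi]; omega

theorem le_add_two_of_adj (h : G.IsGeodesicSeq f d) (hG : G.Connected) {i j : ℕ} {w : V}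
    (hj : j ≤ d) (hwi : G.Adj (f i) w) (hwj : G.Adj (f j) w) : j ≤ i + 2 := by
  rcases le_total i j with hle | hle
  · have h1 := h i j hle hj
    have h2 := hG.dist_triangle (u := f i) (v := w) (w := f j)
    rw [dist_eq_one_iff_adj.2 hwi, dist_eq_one_iff_adj.2 hwj.symm] at h2
    omega
  · omega

theorem reverse (h : G.IsGeodesicSeq f d) : G.IsGeodesicSeq (fun j => f (d - j)) d := by
  intro i j hij hj
  rw [dist_comm, h (d - j) (d - i) (by omega) (by omega)]
  omega

theorem injOn (h : G.IsGeodesicSeq f d) : Set.InjOn f (range (d + 1)) := by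
  intro i hi j hj hij
  simp only [coe_range, Set.mem_Iio] at hi hj
  exact h.eq_of_apply_eq (by omega) (by omega) hij

theorem card_offPath [Fintype V] [DecidableEq V] (h : G.IsGeodesicSeq f d) :
    Fintype.card V = d + 1 + (offPath f d).card := by
  have h1 := Finset.card_sdiff_add_card_eq_card (subset_univ ((range (d + 1)).image f))
  rw [Finset.card_image_of_injOn h.injOn, card_range, card_univ] at h1
  rw [offPath]
  omega

theorem sum_eq_add [Fintype V] [DecidableEq V] (h : G.IsGeodesicSeq f d) (g : V → ℝ) :
    ∑ v, g v = ∑ w ∈ offPath f d, g w + ∑ j ∈ range (d + 1), g (f j) := by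
  rw [offPath, ← Finset.sum_image h.injOn]
  exact (Finset.sum_sdiff (subset_univ _)).symm

variable [DecidableRel G.Adj]

theorem sum_range_adj (h : G.IsGeodesicSeq f d) (y : ℕ → ℝ) {j : ℕ} (hj : j ≤ d) :
    ∑ k ∈ range (d + 1), (if G.Adj (f j) (f k) then y k else 0) =
      (if j < d then y (j + 1) else 0) + if 1 ≤ j then y (j - 1) else 0 := by
  have h1 : ∀ k ∈ range (d + 1), (if G.Adj (f j) (f k) then y k else 0) =
      (if k = j + 1 then y k else 0) + if k = j - 1 then (if 1 ≤ j then y k else 0) else 0 := by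
    intro k hk
    rw [mem_range] at hk
    simp only [h.adj_iff hj (show k ≤ d by omega)]
    split_ifs <;> first | omega | simp
  rw [Finset.sum_congr rfl h1, Finset.sum_add_distrib, Finset.sum_ite_eq', Finset.sum_ite_eq']
  congr 1
  · simp
  · rw [if_pos (mem_range.2 (by omega))]

theorem sum_mul_sum_adj (h : G.IsGeodesicSeq f d) (y : ℕ → ℝ) :
    ∑ j ∈ range (d + 1), y j * ∑ k ∈ range (d + 1), (if G.Adj (f j) (f k) then y k else 0) =
      2 * ∑ j ∈ range d, y j * y (j + 1) := by
  have h1 : ∀ j ∈ range (d + 1),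
      y j * ∑ k ∈ range (d + 1), (if G.Adj (f j) (f k) then y k else 0) =
      (if j < d then y j * y (j + 1) else 0) + if 1 ≤ j then y j * y (j - 1) else 0 := by
    intro j hj
    rw [mem_range] at hj
    rw [h.sum_range_adj y (by omega)]
    split_ifs <;> ring
  rw [Finset.sum_congr rfl h1, Finset.sum_add_distrib, Finset.sum_range_succ,
    Finset.sum_range_succ' _ d, two_mul]
  simp only [lt_irrefl, if_false, add_zero, Nat.add_sub_cancel, le_add_iff_nonneg_left, zero_le,
    if_true, nonpos_iff_eq_zero, one_ne_zero]
  congr 1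
  · exact Finset.sum_congr rfl fun j hj => if_pos (mem_range.1 hj)
  · exact Finset.sum_congr rfl fun j _ => mul_comm _ _

variable [Fintype V] [DecidableEq V]

/-- The missing left neighbour of `f 0` gives the slack that later settles equality; the matching
slack at `f d` is not needed. -/
theorem degree_le (h : G.IsGeodesicSeq f d) {j : ℕ} (hj : j ≤ d) :
    G.degree (f j) + (if j = 0 then 1 else 0) ≤ (G.offNeighbors f d (f j)).card + 2 := by
  have h1 : G.neighborFinset (f j) ⊆ G.offNeighbors f d (f j) ∪
      ((if j = 0 then ∅ else {f (j - 1)}) ∪ {f (j + 1)}) := by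
    intro v hv
    rw [mem_neighborFinset] at hv
    by_cases hP : v ∈ (range (d + 1)).image f
    · obtain ⟨k, hk, rfl⟩ := Finset.mem_image.1 hP
      rw [mem_range] at hk
      rw [h.adj_iff hj (by omega)] at hv
      rcases hv with rfl | rfl
      · simp
      · simp
    · refine mem_union_left _ ?_
      simp only [offNeighbors, offPath, mem_filter, mem_sdiff, mem_univ, true_and]
      exact ⟨hP, hv⟩
  have h2 := (Finset.card_le_card h1).trans (Finset.card_union_le _ _)
  have h3 := Finset.card_union_le (if j = 0 then ∅ else {f (j - 1)}) {f (j + 1)}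
  rw [card_neighborFinset_eq_degree] at h2
  split_ifs at * <;> simp only [card_empty, card_singleton] at h3 <;> omega

theorem dotProduct_mulVec_eq (h : G.IsGeodesicSeq f d) (x : V → ℝ)
    (hx : ∀ w ∈ offPath f d, x w = 0) :
    x ⬝ᵥ G.signlessLapMatrix *ᵥ x = ∑ j ∈ range (d + 1), (G.degree (f j) : ℝ) * x (f j) ^ 2
      + 2 * ∑ j ∈ range d, x (f j) * x (f (j + 1)) := by
  have h1 : ∀ v, ∑ u, (if G.Adj v u then x u else 0) =
      ∑ k ∈ range (d + 1), if G.Adj v (f k) then x (f k) else 0 := by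
    intro v
    rw [h.sum_eq_add, Finset.sum_eq_zero, zero_add]
    intro w hw
    simp [hx w hw]
  rw [← h.sum_mul_sum_adj fun j => x (f j), ← Finset.sum_add_distrib, dotProduct, h.sum_eq_add,
    Finset.sum_eq_zero, zero_add]
  · refine Finset.sum_congr rfl fun j _ => ?_
    rw [signlessLapMatrix_mulVec_apply, h1]
    ring
  · intro w hw
    simp [hx w hw]

/-- The eigenvector equation at `f j` determines `x (f (j + 1))` from earlier entries, so a zero at
the start propagates. -/
theorem eq_zero_of_mulVec_eq (h : G.IsGeodesicSeq f d) {x : V → ℝ} {a : ℝ}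
    (hx : ∀ w ∈ offPath f d, x w = 0) (h0 : x (f 0) = 0)
    (hQ : G.signlessLapMatrix *ᵥ x = a • x) : x = 0 := by
  have key : ∀ j ≤ d, ∀ k ≤ j, x (f k) = 0 := by
    intro j
    induction j with
    | zero => intro _ k hk; rw [Nat.le_zero.1 hk, h0]
    | succ j ih =>
      intro hj k hk
      have ih := ih (by omega)
      rcases Nat.lt_or_ge j k with hjk | hjk
      · obtain rfl : k = j + 1 := by omega
        have h1 := congrFun hQ (f j)
        rw [signlessLapMatrix_mulVec_apply, h.sum_eq_add, Finset.sum_eq_zero, zero_add,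
          h.sum_range_adj (fun k => x (f k)) (by omega), Pi.smul_apply, ih j le_rfl,
          if_pos (by omega), ih (j - 1) (by omega)] at h1
        · simpa using h1
        · intro w hw
          simp [hx w hw]
      · exact ih k hjk
  funext v
  by_cases hv : v ∈ offPath f d
  · exact hx v hv
  · simp only [offPath, mem_sdiff, mem_univ, true_and, not_not] at hv
    obtain ⟨k, hk, rfl⟩ := Finset.mem_image.1 hv
    rw [mem_range] at hk
    exact key d le_rfl k (by omega)

/-- Vanishing off the path costs exactly the m off-path dimensions. The slack `x (f 0) ^ 2` makes
equality force `x (f 0) = 0`, so a non-strict bound is enough. -/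
theorem le_signlessLapEigenvalueCount_add (h : G.IsGeodesicSeq f d) {ι : Type*} [Fintype ι]
    (φ : ι → Module.Dual ℝ (ℕ → ℝ)) (a : ℝ)
    (hle : ∀ y : ℕ → ℝ, (∀ i, φ i y = 0) → 2 * ∑ j ∈ range d, y j * y (j + 1) ≤
      ∑ j ∈ range (d + 1), (a - 2 - ((G.offNeighbors f d (f j)).card : ℝ)) * y j ^ 2) :
    d + 1 ≤ G.signlessLapEigenvalueCount (Set.Ico 0 a) + Fintype.card ι := by
  let ψ : ι ⊕ {w // w ∈ offPath f d} → Module.Dual ℝ (V → ℝ) :=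
    Sum.elim (fun i => φ i ∘ₗ LinearMap.funLeft ℝ ℝ f) fun w => LinearMap.proj w.1
  have hψ : ∀ x : V → ℝ, (∀ i, ψ i x = 0) →
      (∀ w ∈ offPath f d, x w = 0) ∧ ∀ i, φ i (fun j => x (f j)) = 0 := fun x hx =>
    ⟨fun w hw => hx (Sum.inr ⟨w, hw⟩), fun i => hx (Sum.inl i)⟩
  have bound : ∀ x : V → ℝ, (∀ i, ψ i x = 0) →
      x ⬝ᵥ G.signlessLapMatrix *ᵥ x + x (f 0) ^ 2 ≤ a * (x ⬝ᵥ x) := by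
    intro x hx
    obtain ⟨hO, hφ⟩ := hψ x hx
    have h1 : x ⬝ᵥ x = ∑ j ∈ range (d + 1), x (f j) ^ 2 := by
      rw [dotProduct, h.sum_eq_add, Finset.sum_eq_zero, zero_add]
      · simp_rw [sq]
      · intro w hw
        simp [hO w hw]
    have h2 : ∑ j ∈ range (d + 1), (G.degree (f j) : ℝ) * x (f j) ^ 2 + x (f 0) ^ 2 ≤
        ∑ j ∈ range (d + 1), ((G.offNeighbors f d (f j)).card + 2 : ℝ) * x (f j) ^ 2 := by
      have h3 : x (f 0) ^ 2 =
          ∑ j ∈ range (d + 1), (if j = 0 then (1 : ℝ) else 0) * x (f j) ^ 2 := by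
        simp [ite_mul]
      rw [h3, ← Finset.sum_add_distrib]
      refine Finset.sum_le_sum fun j hj => ?_
      rw [← add_mul]
      refine mul_le_mul_of_nonneg_right ?_ (sq_nonneg _)
      rw [mem_range] at hj
      exact_mod_cast h.degree_le (show j ≤ d by omega)
    have h4 := hle _ hφ
    rw [h.dotProduct_mulVec_eq x hO, h1]
    have h5 : a * ∑ j ∈ range (d + 1), x (f j) ^ 2 =
        ∑ j ∈ range (d + 1), (a - 2 - ((G.offNeighbors f d (f j)).card : ℝ)) * x (f j) ^ 2 +
        ∑ j ∈ range (d + 1), ((G.offNeighbors f d (f j)).card + 2 : ℝ) * x (f j) ^ 2 := by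
      rw [← Finset.sum_add_distrib, Finset.mul_sum]
      exact Finset.sum_congr rfl fun j _ => by ring
    linarith
  have h1 := G.card_le_signlessLapEigenvalueCount_add ψ a
    (fun x hx => by linarith [bound x hx, sq_nonneg (x (f 0))]) fun x hx heq hQ => by
      have h0 : x (f 0) ^ 2 = 0 := by
        linarith [bound x hx, sq_nonneg (x (f 0))]
      exact h.eq_zero_of_mulVec_eq (hψ x hx).1 (pow_eq_zero_iff two_ne_zero |>.1 h0) hQ
  rw [h.card_offPath, Fintype.card_sum, Fintype.card_coe] at h1
  omega

end IsGeodesicSeq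

end SimpleGraph

/-! ### Path test vectors and edge weights -/

theorem two_mul_sum_mul_succ_le {d : ℕ} {y α β c : ℕ → ℝ}
    (hedge : ∀ j < d, 2 * (y j * y (j + 1)) ≤ α j * y j ^ 2 + β (j + 1) * y (j + 1) ^ 2)
    (hα : 0 ≤ α d) (hβ : 0 ≤ β 0) (hc : ∀ j ≤ d, α j + β j ≤ c j) :
    2 * ∑ j ∈ range d, y j * y (j + 1) ≤ ∑ j ∈ range (d + 1), c j * y j ^ 2 := by
  have h1 : ∑ j ∈ range d, 2 * (y j * y (j + 1)) ≤
      ∑ j ∈ range d, (α j * y j ^ 2 + β (j + 1) * y (j + 1) ^ 2) :=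
    Finset.sum_le_sum fun j hj => hedge j (mem_range.1 hj)
  have h2 : ∑ j ∈ range (d + 1), (α j + β j) * y j ^ 2 ≤ ∑ j ∈ range (d + 1), c j * y j ^ 2 :=
    Finset.sum_le_sum fun j hj => mul_le_mul_of_nonneg_right
      (hc j (Nat.lt_succ_iff.1 (mem_range.1 hj))) (sq_nonneg _)
  -- Regrouped by vertex, the weights `α d` and `β 0` belong to no edge.
  have h3 : ∑ j ∈ range (d + 1), (α j + β j) * y j ^ 2 =
      ∑ j ∈ range d, (α j * y j ^ 2 + β (j + 1) * y (j + 1) ^ 2) +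
        (α d * y d ^ 2 + β 0 * y 0 ^ 2) := by
    simp_rw [add_mul, Finset.sum_add_distrib]
    rw [Finset.sum_range_succ, Finset.sum_range_succ' (fun j => β j * y j ^ 2)]
    ring
  rw [← Finset.mul_sum] at h1
  have := mul_nonneg hα (sq_nonneg (y d))
  have := mul_nonneg hβ (sq_nonneg (y 0))
  linarith

/-- The functional `y ↦ y p + y (p + 1)` on real sequences. -/
def addSuccDual (p : ℕ) : Module.Dual ℝ (ℕ → ℝ) where
  toFun y := y p + y (p + 1)
  map_add' y z := by simp only [Pi.add_apply]; ring
  map_smul' a y := by simp only [Pi.smul_apply, smul_eq_mul, RingHom.id_apply]; ring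

namespace SimpleGraph

namespace IsGeodesicSeq

variable {V : Type*} [Fintype V] [DecidableEq V] {G : SimpleGraph V} [DecidableRel G.Adj]
  {f : ℕ → V} {d : ℕ}

/-- Setting y = 0 on `Z` deletes those path vertices. Each survivor pays 1 per surviving path
neighbour, and the indicators count the missing ones. -/
theorem le_signlessLapEigenvalueCount_add_card (h : G.IsGeodesicSeq f d) (t : ℕ) (Z : Finset ℕ)
    (hZ : ∀ k ≤ d, k ∉ Z → (G.offNeighbors f d (f k)).card + 2 ≤
      t + (if k = 0 ∨ k - 1 ∈ Z then 1 else 0) + if k = d ∨ k + 1 ∈ Z then 1 else 0) :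
    d + 1 ≤ G.signlessLapEigenvalueCount (Set.Ico 0 ((t : ℝ) + 2)) + Z.card := by
  have := h.le_signlessLapEigenvalueCount_add
    (fun i : Z => (LinearMap.proj i.1 : Module.Dual ℝ (ℕ → ℝ))) ((t : ℝ) + 2) ?_
  · rwa [Fintype.card_coe] at this
  intro y hy
  have hy : ∀ i ∈ Z, y i = 0 := fun i hi => hy ⟨i, hi⟩
  have hsum : ∑ j ∈ range (d + 1), ((t : ℝ) + 2 - 2 - ((G.offNeighbors f d (f j)).card : ℝ)) *
      y j ^ 2 = ∑ j ∈ range (d + 1), (if j ∈ Z then 0 else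
        (t : ℝ) - ((G.offNeighbors f d (f j)).card : ℝ)) * y j ^ 2 := by
    refine Finset.sum_congr rfl fun j _ => ?_
    split_ifs with hj
    · simp [hy j hj]
    · ring
  rw [hsum]
  refine two_mul_sum_mul_succ_le
    (α := fun j => if j ∈ Z ∨ j = d ∨ j + 1 ∈ Z then 0 else 1)
    (β := fun j => if j ∈ Z ∨ j = 0 ∨ j - 1 ∈ Z then 0 else 1) ?_ ?_ ?_ ?_
  · intro j hj
    by_cases h1 : j ∈ Z
    · simp [hy j h1, h1]
    by_cases h2 : j + 1 ∈ Z
    · simp [hy _ h2, h2]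
    simp only [h1, h2, hj.ne, Nat.add_sub_cancel, Nat.succ_ne_zero, or_self, if_false]
    nlinarith [sq_nonneg (y j - y (j + 1))]
  · simp
  · simp
  · intro j hj
    by_cases h1 : j ∈ Z
    · simp [h1]
    have h2 := hZ j hj h1
    have h3 : ((G.offNeighbors f d (f j)).card + 2 : ℝ) ≤
      t + (if j = 0 ∨ j - 1 ∈ Z then 1 else 0) + if j = d ∨ j + 1 ∈ Z then 1 else 0 := by
      exact_mod_cast h2
    simp only [h1, false_or, if_false]
    split_ifs at h3 ⊢ <;> linarith

theorem offNeighbors_card_le (u : V) :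
    (G.offNeighbors f d u).card ≤ (offPath f d).card :=
  Finset.card_le_card (Finset.filter_subset _ _)

theorem disjoint_offNeighbors (h : G.IsGeodesicSeq f d) (hG : G.Connected) {i j : ℕ}
    (hij : i + 3 ≤ j) (hj : j ≤ d) :
    Disjoint (G.offNeighbors f d (f i)) (G.offNeighbors f d (f j)) := by
  rw [Finset.disjoint_left]
  intro w hi hj'
  have := h.le_add_two_of_adj hG hj (mem_filter.1 hi).2 (mem_filter.1 hj').2
  omega

theorem offNeighbors_card_add_le (h : G.IsGeodesicSeq f d) (hG : G.Connected) {i j : ℕ}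
    (hij : i + 3 ≤ j) (hj : j ≤ d) :
    (G.offNeighbors f d (f i)).card + (G.offNeighbors f d (f j)).card ≤ (offPath f d).card := by
  rw [← Finset.card_union_of_disjoint (h.disjoint_offNeighbors hG hij hj)]
  exact Finset.card_le_card (union_subset (filter_subset _ _) (filter_subset _ _))

/-- A property of the indices `0, …, d` that holds at no two indices of distance at least three
holds only inside some interval `{i - 1, i, i + 1}` contained in `{0, …, d}`. -/
theorem _root_.Nat.exists_center {d : ℕ} (hd : 2 ≤ d) (p : ℕ → Prop)
    (hp : ∀ i j, i + 3 ≤ j → j ≤ d → p i → ¬ p j) :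
    ∃ i, 1 ≤ i ∧ i + 1 ≤ d ∧ ∀ k ≤ d, p k → i ≤ k + 1 ∧ k ≤ i + 1 := by
  classical
  by_cases hex : ∃ k, k ≤ d ∧ p k
  · obtain ⟨hd', hp'⟩ := Nat.find_spec hex
    refine ⟨min (Nat.find hex + 1) (d - 1), by omega, by omega, fun k hk hpk => ?_⟩
    have h1 := Nat.find_min' hex ⟨hk, hpk⟩
    have h2 : ¬ Nat.find hex + 3 ≤ k := fun h => hp _ _ h hk hp' hpk
    omega
  · exact ⟨1, le_rfl, hd, fun k hk hpk => absurd ⟨k, hk, hpk⟩ hex⟩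

/-- Two violating indices three apart would have disjoint off-path neighbourhoods of size at least m
- 1, but 2(m - 1) > m. -/
theorem exists_center (h : G.IsGeodesicSeq f d) (hG : G.Connected) (hd : 2 ≤ d)
    (hm : 3 ≤ (offPath f d).card) :
    ∃ i, 1 ≤ i ∧ i + 1 ≤ d ∧ ∀ k ≤ d, k + 1 < i ∨ i + 1 < k →
      (G.offNeighbors f d (f k)).card + 2 ≤ (offPath f d).card := by
  obtain ⟨i, h1, h2, h3⟩ := Nat.exists_center hd
    (fun k => (offPath f d).card < (G.offNeighbors f d (f k)).card + 2) fun i j hij hj hi hj' => by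
      have := h.offNeighbors_card_add_le hG hij hj
      omega
  refine ⟨i, h1, h2, fun k hk hki => ?_⟩
  by_contra hlt
  have := h3 k hk (by omega)
  omega

theorem le_count_add_two_of_center (h : G.IsGeodesicSeq f d) {i : ℕ} (h1 : 1 ≤ i)
    (hi : ∀ k ≤ d, k + 1 < i ∨ i + 1 < k →
      (G.offNeighbors f d (f k)).card + 2 ≤ (offPath f d).card) :
    d + 1 ≤ G.signlessLapEigenvalueCount (Set.Ico 0 (((offPath f d).card : ℝ) + 2)) + 2 := by
  have := h.le_signlessLapEigenvalueCount_add_card (offPath f d).card {i - 1, i + 1} ?_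
  · rwa [Finset.card_pair (by omega)] at this
  intro k hk hkZ
  simp only [mem_insert, mem_singleton, not_or] at hkZ ⊢
  by_cases hki : k = i
  · subst hki
    have := offNeighbors_card_le (G := G) (f := f) (d := d) (f k)
    simpa using this
  · have := hi k hk (by omega)
    omega

theorem le_count_add_two (h : G.IsGeodesicSeq f d) (hG : G.Connected) (hd : 2 ≤ d)
    (hm : 2 ≤ (offPath f d).card) :
    d + 1 ≤ G.signlessLapEigenvalueCount (Set.Ico 0 (((offPath f d).card : ℝ) + 2)) + 2 := by
  rcases hm.eq_or_lt with hm | hm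
  · obtain ⟨w, w', hww, hO⟩ := Finset.card_eq_two.1 hm.symm
    have center : ∀ w : V, ∃ i, 1 ≤ i ∧ i + 1 ≤ d ∧
        ∀ k ≤ d, G.Adj (f k) w → i ≤ k + 1 ∧ k ≤ i + 1 := fun w =>
      Nat.exists_center hd _ fun i j hij hj hi hj' => by
        have := h.le_add_two_of_adj hG hj hi hj'
        omega
    obtain ⟨i, hi1, hid, hi⟩ := center w
    obtain ⟨j, hj1, hjd, hj⟩ := center w'
    have hD : ∀ k ≤ d, (G.offNeighbors f d (f k)).card ≤
        (if i ≤ k + 1 ∧ k ≤ i + 1 then 1 else 0) + if j ≤ k + 1 ∧ k ≤ j + 1 then 1 else 0 := by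
      intro k hk
      rw [offNeighbors, hO, Finset.card_filter, Finset.sum_pair hww]
      refine add_le_add ?_ ?_
      · split_ifs with h1 h2 <;> simp_all
      · split_ifs with h1 h2 <;> simp_all
    by_cases hij : i = j
    · subst hij
      refine h.le_count_add_two_of_center hi1 fun k hk hki => ?_
      have := hD k hk
      rw [if_neg (by omega)] at this
      omega
    · have := h.le_signlessLapEigenvalueCount_add_card (offPath f d).card {i, j} ?_
      · rwa [Finset.card_pair hij] at this
      intro k hk hkZ
      simp only [mem_insert, mem_singleton, not_or] at hkZ ⊢
      have := hD k hk
      split_ifs at this ⊢ <;> omega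
  · obtain ⟨i, h1, -, hi⟩ := h.exists_center hG hd hm
    exact h.le_count_add_two_of_center h1 hi

/-- Under the condition the edge term at p is -2 y_p², so `α p` and `β (p + 1)` may be negative,
relieving both ends of that edge. -/
theorem le_count_add_one_of_add_succ (h : G.IsGeodesicSeq f d) {p : ℕ} (t : ℕ) (α β : ℕ → ℝ)
    (hedge : ∀ y : ℕ → ℝ, y p + y (p + 1) = 0 → ∀ j < d,
      2 * (y j * y (j + 1)) ≤ α j * y j ^ 2 + β (j + 1) * y (j + 1) ^ 2)
    (hα : 0 ≤ α d) (hβ : 0 ≤ β 0)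
    (hc : ∀ j ≤ d, α j + β j + (G.offNeighbors f d (f j)).card ≤ t) :
    d + 1 ≤ G.signlessLapEigenvalueCount (Set.Ico 0 ((t : ℝ) + 2)) + 1 := by
  refine h.le_signlessLapEigenvalueCount_add  (fun _ : Unit => addSuccDual p) _ fun y hy =>
    two_mul_sum_mul_succ_le (hedge y (hy ())) hα hβ fun j hj => ?_
  linarith [hc j hj]

theorem le_count_add_one_of_card_eq (h : G.IsGeodesicSeq f d) (hG : G.Connected) {p : ℕ}
    (hm : 4 ≤ (offPath f d).card) (hpd : p + 2 ≤ d)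
    (hp : ∀ k ≤ d, k < p ∨ p + 2 < k →
      (G.offNeighbors f d (f k)).card + 2 ≤ (offPath f d).card)
    (h0 : (G.offNeighbors f d (f p)).card = (offPath f d).card)
    (h2 : (G.offNeighbors f d (f (p + 2))).card < (offPath f d).card) :
    d + 1 ≤ G.signlessLapEigenvalueCount (Set.Ico 0 (((offPath f d).card : ℝ) + 2)) + 1 := by
  set m := (offPath f d).card with hm'
  have h1 : (G.offNeighbors f d (f (p + 1))).card ≤ m := offNeighbors_card_le _
  have hm4 : (4 : ℝ) ≤ m := by exact_mod_cast hm
  have hpR : ∀ k ≤ d, k < p ∨ p + 2 < k → ((G.offNeighbors f d (f k)).card : ℝ) + 2 ≤ m :=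
    fun k hk hkp => by exact_mod_cast hp k hk hkp
  have h0R : ((G.offNeighbors f d (f p)).card : ℝ) = m := by exact_mod_cast h0
  have h1R : ((G.offNeighbors f d (f (p + 1))).card : ℝ) ≤ m := by exact_mod_cast h1
  by_cases h2' : (G.offNeighbors f d (f (p + 2))).card + 2 ≤ m
  · have h2R : ((G.offNeighbors f d (f (p + 2))).card : ℝ) + 2 ≤ m := by exact_mod_cast h2'
    by_cases h1' : (G.offNeighbors f d (f (p + 1))).card = m
    · refine h.le_count_add_one_of_add_succ (p := p) m (fun j => if j = p then -1 else 1)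
        (fun j => if j = p + 1 then -1 else 1) ?_ ?_ ?_ ?_
      · intro y hy j hj
        by_cases hjp : j = p
        · subst hjp
          have : y (j + 1) = - y j := by linarith
          simp only [if_true, this]
          nlinarith
        · simp only [hjp, if_false, Nat.add_right_cancel_iff]
          nlinarith [sq_nonneg (y j - y (j + 1))]
      · rw [if_neg (by omega)]; norm_num
      · rw [if_neg (by omega)]; norm_num
      · intro j hj
        rcases lt_trichotomy j p with hjp | rfl | hjp
        · rw [if_neg (by omega), if_neg (by omega)]
          linarith [hpR j hj (by omega)]
        · rw [if_pos rfl, if_neg (by omega)]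
          linarith
        · rw [if_neg (by omega)]
          split_ifs with hj1
          · subst hj1; linarith
          · by_cases hj2 : j = p + 2
            · subst hj2; linarith
            · linarith [hpR j hj (by omega)]
    -- Since `f (p + 1)` misses an off-path vertex, deleting `f p` is enough.
    · have := h.le_signlessLapEigenvalueCount_add_card m {p} ?_
      · rwa [Finset.card_singleton] at this
      intro k hk hkp
      simp only [mem_singleton] at hkp ⊢
      by_cases hk1 : k = p + 1
      · subst hk1
        rw [if_pos (Or.inr (by omega))]
        omega
      by_cases hk2 : k = p + 2
      · subst hk2
        omega
      have := hp k hk (by omega)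
      omega
  · have h2R : ((G.offNeighbors f d (f (p + 2))).card : ℝ) + 1 ≤ m := by exact_mod_cast h2
    -- Now `f (p + 2)` misses exactly one off-path vertex and can carry only 1 = 2/3 + 1/3. Edge p
    -- takes (-1/2, -3/2); the other altered edges take pairs of product 1: (2, 1/2), (3/2, 2/3),
    -- (1/3, 3). The totals at p and p + 1 are 0. The loads 3 at p - 1 and 4 at p + 3 fit because
    -- these have at most one and no off-path neighbours, and m ≥ 4.
    refine h.le_count_add_one_of_add_succ (p := p) m
      (fun j => if j = p then -1 / 2 else if j + 1 = p then 2 else if j = p + 1 then 3 / 2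
        else if j = p + 2 then 1 / 3 else 1)
      (fun j => if j = p then 1 / 2 else if j = p + 1 then -3 / 2 else if j = p + 2 then 2 / 3
        else if j = p + 3 then 3 else 1) ?_ ?_ ?_ ?_
    · intro y hy j hj
      by_cases hj0 : j = p
      · subst hj0
        have : y (j + 1) = - y j := by linarith
        rw [if_pos rfl, if_neg (by omega), if_pos rfl, this]
        nlinarith
      by_cases hj1 : j + 1 = p
      · rw [if_neg hj0, if_pos hj1, if_pos hj1]
        nlinarith [sq_nonneg (2 * y j - y (j + 1))]
      by_cases hj2 : j = p + 1
      · rw [if_neg hj0, if_neg hj1, if_pos hj2, if_neg hj1, if_neg (by omega), if_pos (by omega)]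
        nlinarith [sq_nonneg (3 * y j - 2 * y (j + 1))]
      by_cases hj3 : j = p + 2
      · rw [if_neg hj0, if_neg hj1, if_neg hj2, if_pos hj3, if_neg hj1, if_neg (by omega),
          if_neg (by omega), if_pos (by omega)]
        nlinarith [sq_nonneg (y j - 3 * y (j + 1))]
      rw [if_neg hj0, if_neg hj1, if_neg hj2, if_neg hj3, if_neg hj1, if_neg (by omega),
          if_neg (by omega), if_neg (by omega)]
      nlinarith [sq_nonneg (y j - y (j + 1))]
    · rw [if_neg (by omega), if_neg (by omega)]
      split_ifs <;> norm_num
    · rw [if_neg (show ¬ 0 = p + 1 by omega)]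
      split_ifs <;> norm_num
    · intro j hj
      by_cases hj0 : j = p
      · rw [if_pos hj0, if_pos hj0, hj0]
        linarith
      by_cases hj1 : j + 1 = p
      · rw [if_neg hj0, if_pos hj1, if_neg hj0, if_neg (by omega), if_neg (by omega),
          if_neg (by omega)]
        have h3 := h.offNeighbors_card_add_le hG (i := j) (j := p + 2) (by omega) hpd
        have h4 : (G.offNeighbors f d (f j)).card + 3 ≤ m := by omega
        have h5 : ((G.offNeighbors f d (f j)).card : ℝ) + 3 ≤ m := by exact_mod_cast h4
        linarith
      by_cases hj2 : j = p + 1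
      · rw [if_neg hj0, if_neg hj1, if_pos hj2, if_neg hj0, if_pos hj2, hj2]
        linarith
      by_cases hj3 : j = p + 2
      · rw [if_neg hj0, if_neg hj1, if_neg hj2, if_pos hj3, if_neg hj0, if_neg hj2, if_pos hj3,
          hj3]
        linarith
      rw [if_neg hj0, if_neg hj1, if_neg hj2, if_neg hj3, if_neg hj0, if_neg hj2, if_neg hj3]
      split_ifs with hj4
      · have h3 := h.offNeighbors_card_add_le hG (i := p) (j := j) (by omega) hj
        have h4 : (G.offNeighbors f d (f j)).card = 0 := by omega
        rw [h4]
        norm_num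
        linarith
      · linarith [hpR j hj (by omega)]

end IsGeodesicSeq

end SimpleGraph

/-! ### Both window ends see every off-path vertex; final case analysis -/

namespace SimpleGraph

namespace IsGeodesicSeq

variable {V : Type*} [Fintype V] [DecidableEq V] {G : SimpleGraph V} {f : ℕ → V} {d : ℕ}

theorem mem_offPath_iff {v : V} : v ∈ offPath f d ↔ ∀ k ≤ d, f k ≠ v := by
  simp [offPath]

theorem offPath_reverse : offPath (fun j => f (d - j)) d = offPath f d := by
  ext v
  rw [mem_offPath_iff, mem_offPath_iff]
  refine ⟨fun h k hk => ?_, fun h k _ => h _ (by omega)⟩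
  have := h (d - k) (by omega)
  rwa [Nat.sub_sub_self hk] at this

theorem eq_or_eq_of_adj (h : G.IsGeodesicSeq f d) (hG : G.Connected) {i : ℕ} (h1 : 1 ≤ i)
    (hid : i + 1 ≤ d)
    (hO : ∀ w ∈ offPath f d, G.Adj (f (i - 1)) w ∧ G.Adj (f (i + 1)) w) {v u : V}
    (hv : v ∈ insert (f i) (offPath f d)) (hu : u ∉ insert (f i) (offPath f d))
    (hvu : G.Adj v u) : u = f (i - 1) ∨ u = f (i + 1) := by
  rw [mem_insert, not_or] at hu
  obtain ⟨hui, huO⟩ := hu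
  rw [mem_offPath_iff] at huO
  push Not at huO
  obtain ⟨k, hk, rfl⟩ := huO
  have hki : k ≠ i := fun e => hui (by rw [e])
  have : k = i - 1 ∨ k = i + 1 := by
    rcases mem_insert.1 hv with rfl | hv
    · have := (h.adj_iff (by omega) hk).1 hvu
      omega
    · have h3 := h.le_add_two_of_adj hG hk (hO v hv).1 hvu.symm
      have h4 := h.le_add_two_of_adj hG hid hvu.symm (hO v hv).2
      omega
  rcases this with rfl | rfl
  · exact Or.inl rfl
  · exact Or.inr rfl

variable [DecidableRel G.Adj]

theorem card_filter_adj_le_two (h : G.IsGeodesicSeq f d) {S : Finset V}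
    (hS : Disjoint S (offPath f d)) {v : V} (hv : v ∈ S) :
    (S.filter (G.Adj v)).card ≤ 2 := by
  have hmem : ∀ u ∈ S, ∃ k ≤ d, f k = u := by
    intro u hu
    have := Finset.disjoint_left.1 hS hu
    rw [mem_offPath_iff] at this
    push Not at this
    exact this
  obtain ⟨j, hj, rfl⟩ := hmem v hv
  refine (Finset.card_le_card (t := {f (j - 1), f (j + 1)}) ?_).trans Finset.card_le_two
  intro u hu
  obtain ⟨huS, hadj⟩ := mem_filter.1 hu
  obtain ⟨k, hk, rfl⟩ := hmem u huS
  rcases (h.adj_iff hj hk).1 hadj with rfl | rfl <;> simp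

/-- Let H be `f i` with the off-path vertices. Inside H, comparison with the complete graph gives
|H| - 2 on zero-sum vectors; edges leaving H reach only `f (i - 1)` and `f (i + 1)`, where x
vanishes, and add at most 2. The complement induces degrees at most 2, whence the 4. -/
theorem dotProduct_mulVec_le (h : G.IsGeodesicSeq f d) (hG : G.Connected) {i : ℕ} (h1 : 1 ≤ i)
    (hid : i + 1 ≤ d)
    (hO : ∀ w ∈ offPath f d, G.Adj (f (i - 1)) w ∧ G.Adj (f (i + 1)) w) (x : V → ℝ)
    (ha : x (f (i - 1)) = 0) (hb : x (f (i + 1)) = 0)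
    (hsum : ∑ v ∈ insert (f i) (offPath f d), x v = 0) :
    x ⬝ᵥ G.signlessLapMatrix *ᵥ x ≤
      ((insert (f i) (offPath f d)).card : ℝ) * ∑ v ∈ insert (f i) (offPath f d), x v ^ 2 +
        4 * ∑ v ∈ (insert (f i) (offPath f d))ᶜ, x v ^ 2 := by
  have hcross := fun v u => h.eq_or_eq_of_adj (v := v) (u := u) hG h1 hid hO
  set H := insert (f i) (offPath f d) with hH
  set F : V → V → ℝ := fun v u => if G.Adj v u then (x v + x u) ^ 2 else 0 with hF
  have hQ : 2 * (x ⬝ᵥ G.signlessLapMatrix *ᵥ x) =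
      (∑ v ∈ H, ∑ u ∈ H, F v u + ∑ v ∈ H, ∑ u ∈ Hᶜ, F v u) +
        (∑ v ∈ Hᶜ, ∑ u ∈ H, F v u + ∑ v ∈ Hᶜ, ∑ u ∈ Hᶜ, F v u) := by
    rw [two_mul_dotProduct_signlessLapMatrix_mulVec, ← Finset.sum_add_sum_compl H,
      ← Finset.sum_add_distrib, ← Finset.sum_add_distrib]
    simp_rw [Finset.sum_add_sum_compl]
    rfl
  have hsymm : ∑ v ∈ Hᶜ, ∑ u ∈ H, F v u = ∑ v ∈ H, ∑ u ∈ Hᶜ, F v u := by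
    rw [Finset.sum_comm]
    refine Finset.sum_congr rfl fun v _ => Finset.sum_congr rfl fun u _ => ?_
    simp only [hF, G.adj_comm u v, add_comm (x u)]
  have hHH : ∑ v ∈ H, ∑ u ∈ H, F v u ≤ (2 * (H.card : ℝ) - 4) * ∑ v ∈ H, x v ^ 2 := by
    have e1 : ∑ v ∈ H, ∑ u ∈ H, F v u ≤
        ∑ v ∈ H, ∑ u ∈ H, ((x v + x u) ^ 2 - if v = u then 4 * x v ^ 2 else 0) := by
      refine Finset.sum_le_sum fun v _ => Finset.sum_le_sum fun u _ => ?_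
      by_cases hvu : v = u
      · subst hvu
        simp only [hF, G.irrefl, if_false, if_true]
        nlinarith
      · simp only [hF, hvu, if_false, sub_zero]
        split_ifs
        · exact le_rfl
        · positivity
    have e2 : ∀ v ∈ H, ∑ u ∈ H, ((x v + x u) ^ 2 - if v = u then 4 * x v ^ 2 else 0) =
        ((H.card : ℝ) - 4) * x v ^ 2 + ∑ u ∈ H, x u ^ 2 := by
      intro v hv
      have e3 : ∀ u, (x v + x u) ^ 2 = x v ^ 2 + 2 * x v * x u + x u ^ 2 := fun u => by ring
      simp_rw [Finset.sum_sub_distrib, e3, Finset.sum_add_distrib, ← Finset.mul_sum, hsum]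
      rw [Finset.sum_ite_eq, if_pos hv, Finset.sum_const, nsmul_eq_mul]
      ring
    refine e1.trans (le_of_eq ?_)
    rw [Finset.sum_congr rfl e2, Finset.sum_add_distrib, ← Finset.mul_sum, Finset.sum_const,
      nsmul_eq_mul]
    ring
  have hHC : ∑ v ∈ H, ∑ u ∈ Hᶜ, F v u ≤ 2 * ∑ v ∈ H, x v ^ 2 := by
    rw [Finset.mul_sum]
    refine Finset.sum_le_sum fun v hv => ?_
    have e1 : ∑ u ∈ Hᶜ, F v u ≤ ∑ u ∈ Hᶜ, ((if u = f (i - 1) then x v ^ 2 else 0) +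
        if u = f (i + 1) then x v ^ 2 else 0) := by
      refine Finset.sum_le_sum fun u hu => ?_
      simp only [hF]
      by_cases hvu : G.Adj v u
      · rcases hcross v u hv (mem_compl.1 hu) hvu with rfl | rfl
        · rw [if_pos hvu, if_pos rfl, ha, add_zero]
          split_ifs <;> nlinarith [sq_nonneg (x v)]
        · rw [if_pos hvu, if_pos rfl, hb, add_zero]
          split_ifs <;> nlinarith [sq_nonneg (x v)]
      · rw [if_neg hvu]
        positivity
    refine e1.trans ?_
    rw [Finset.sum_add_distrib, Finset.sum_ite_eq', Finset.sum_ite_eq']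
    split_ifs <;> nlinarith [sq_nonneg (x v)]
  have hCC : ∑ v ∈ Hᶜ, ∑ u ∈ Hᶜ, F v u ≤ 8 * ∑ v ∈ Hᶜ, x v ^ 2 := by
    have e1 : ∑ v ∈ Hᶜ, ∑ u ∈ Hᶜ, F v u ≤
        ∑ v ∈ Hᶜ, ∑ u ∈ Hᶜ, ((if G.Adj v u then 2 * x v ^ 2 else 0) +
          if G.Adj v u then 2 * x u ^ 2 else 0) := by
      refine Finset.sum_le_sum fun v _ => Finset.sum_le_sum fun u _ => ?_
      simp only [hF]
      split_ifs
      · nlinarith [sq_nonneg (x v - x u)]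
      · simp
    have e2 : ∑ v ∈ Hᶜ, ∑ u ∈ Hᶜ, (if G.Adj v u then 2 * x u ^ 2 else 0) =
        ∑ v ∈ Hᶜ, ∑ u ∈ Hᶜ, (if G.Adj v u then 2 * x v ^ 2 else 0) := by
      rw [Finset.sum_comm]
      simp_rw [G.adj_comm]
    have e3 : ∑ v ∈ Hᶜ, ∑ u ∈ Hᶜ, (if G.Adj v u then 2 * x v ^ 2 else 0) ≤
        ∑ v ∈ Hᶜ, 4 * x v ^ 2 := by
      refine Finset.sum_le_sum fun v hv => ?_
      have hdisj : Disjoint Hᶜ (offPath f d) := by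
        rw [Finset.disjoint_left]
        exact fun u hu hu' => mem_compl.1 hu (mem_insert_of_mem hu')
      have e4 : ((Hᶜ.filter (G.Adj v)).card : ℝ) ≤ 2 := by
        exact_mod_cast h.card_filter_adj_le_two hdisj hv
      rw [← Finset.sum_filter, Finset.sum_const, nsmul_eq_mul]
      nlinarith [sq_nonneg (x v)]
    simp_rw [Finset.sum_add_distrib] at e1
    rw [e2] at e1
    rw [← Finset.mul_sum] at e3
    linarith
  linarith

/-- Both m + 1 and 4 are at most (m + 2) - 1, and the spare ‖x‖² rules out equality. -/
theorem card_le_count_add_three (h : G.IsGeodesicSeq f d) (hG : G.Connected)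
    (hm : 3 ≤ (offPath f d).card) {i : ℕ} (h1 : 1 ≤ i) (hid : i + 1 ≤ d)
    (hO : ∀ w ∈ offPath f d, G.Adj (f (i - 1)) w ∧ G.Adj (f (i + 1)) w) :
    Fintype.card V ≤
      G.signlessLapEigenvalueCount (Set.Ico 0 (((offPath f d).card : ℝ) + 2)) + 3 := by
  set H := insert (f i) (offPath f d) with hH
  have hcard : H.card = (offPath f d).card + 1 :=
    Finset.card_insert_of_notMem fun hi => mem_offPath_iff.1 hi i (by omega) rfl
  have bound : ∀ x : V → ℝ, x (f (i - 1)) = 0 → x (f (i + 1)) = 0 → ∑ v ∈ H, x v = 0 →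
      x ⬝ᵥ G.signlessLapMatrix *ᵥ x + x ⬝ᵥ x ≤ (((offPath f d).card : ℝ) + 2) * (x ⬝ᵥ x) := by
    intro x ha hb hs
    have e1 := h.dotProduct_mulVec_le hG h1 hid hO x ha hb hs
    rw [← hH, hcard] at e1
    have e2 : x ⬝ᵥ x = ∑ v ∈ H, x v ^ 2 + ∑ v ∈ Hᶜ, x v ^ 2 := by
      rw [Finset.sum_add_sum_compl, dotProduct]
      simp_rw [sq]
    have e3 : 0 ≤ ∑ v ∈ Hᶜ, x v ^ 2 := Finset.sum_nonneg fun v _ => sq_nonneg _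
    have hmR : (3 : ℝ) ≤ (offPath f d).card := by exact_mod_cast hm
    rw [e2]
    push_cast at e1
    nlinarith [mul_nonneg (sub_nonneg.2 hmR) e3]
  let φ : Fin 3 → Module.Dual ℝ (V → ℝ) :=
    ![LinearMap.proj (f (i - 1)), LinearMap.proj (f (i + 1)), ∑ v ∈ H, LinearMap.proj v]
  have hφ : ∀ x : V → ℝ, (∀ k, φ k x = 0) →
      x ⬝ᵥ G.signlessLapMatrix *ᵥ x + x ⬝ᵥ x ≤ (((offPath f d).card : ℝ) + 2) * (x ⬝ᵥ x) := by
    intro x hx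
    refine bound x (hx 0) (hx 1) ?_
    simpa [φ, LinearMap.sum_apply] using hx 2
  have hnn : ∀ x : V → ℝ, 0 ≤ x ⬝ᵥ x := fun x =>
    Finset.sum_nonneg fun v _ => mul_self_nonneg _
  have := G.card_le_signlessLapEigenvalueCount_add φ (((offPath f d).card : ℝ) + 2)
    (fun x hx => by linarith [hφ x hx, hnn x]) fun x hx heq _ =>
      dotProduct_self_eq_zero.1 (le_antisymm (by linarith [hφ x hx]) (hnn x))
  rwa [Fintype.card_fin] at this

theorem offNeighbors_reverse (v : V) :
    G.offNeighbors (fun j => f (d - j)) d v = G.offNeighbors f d v := by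
  rw [offNeighbors, offPath_reverse, offNeighbors]

theorem le_signlessLapEigenvalueCount (h : G.IsGeodesicSeq f d) (hG : G.Connected) (hd : 2 ≤ d)
    (hm : 4 ≤ (offPath f d).card) :
    d ≤ G.signlessLapEigenvalueCount (Set.Ico 0 (((offPath f d).card : ℝ) + 2)) := by
  obtain ⟨i, h1, hid, hi⟩ := h.exists_center hG hd (by omega)
  have hle := fun v => offNeighbors_card_le (G := G) (f := f) (d := d) v
  -- If neither window end sees all off-path vertices, deleting `f i` suffices. If exactly one does,
  -- the weighted bound applies, after reversing the path when it is the right end.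
  rcases (hle (f (i - 1))).lt_or_eq with ha | ha <;> rcases (hle (f (i + 1))).lt_or_eq with hb | hb
  · have := h.le_signlessLapEigenvalueCount_add_card (offPath f d).card {i} ?_
    · rw [Finset.card_singleton] at this
      omega
    intro k hk hki
    simp only [mem_singleton] at hki ⊢
    by_cases hk1 : k + 1 = i
    · obtain rfl : k = i - 1 := by omega
      split_ifs <;> omega
    by_cases hk2 : k = i + 1
    · subst hk2
      split_ifs <;> omega
    have := hi k hk (by omega)
    omega
  · have := h.reverse.le_count_add_one_of_card_eq hG (p := d - i - 1)
    simp only [offPath_reverse, offNeighbors_reverse] at this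
    have := this hm (by omega) (fun k hk hkp => hi (d - k) (by omega) (by omega))
      (by rwa [show d - (d - i - 1) = i + 1 by omega])
      (by rwa [show d - (d - i - 1 + 2) = i - 1 by omega])
    omega
  · have := h.le_count_add_one_of_card_eq hG (p := i - 1) hm (by omega)
      (fun k hk hkp => hi k hk (by omega)) ha (by rwa [show i - 1 + 2 = i + 1 by omega])
    omega
  · have hall : ∀ j, (G.offNeighbors f d (f j)).card = (offPath f d).card →
        ∀ w ∈ offPath f d, G.Adj (f j) w := fun j hj w hw => by
      have := Finset.eq_of_subset_of_card_le (Finset.filter_subset _ _) hj.ge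
      rw [← this] at hw
      exact (mem_filter.1 hw).2
    have := h.card_le_count_add_three hG (by omega) h1 hid fun w hw =>
      ⟨hall _ ha w hw, hall _ hb w hw⟩
    rw [h.card_offPath] at this
    omega

theorem le_count_add_one_of_card (h : G.IsGeodesicSeq f d) :
    d ≤ G.signlessLapEigenvalueCount (Set.Ico 0 ((Fintype.card V : ℝ) - 2)) + 1 := by
  have hle := fun v => offNeighbors_card_le (G := G) (f := f) (d := d) v
  have hn := h.card_offPath
  -- Here t = m + (d - 3), and off-path counts are at most m, leaving only 2 ≤ (d - 3) + missing
  -- neighbours.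
  have key : ∀ Z : Finset ℕ, Z.card ≤ 2 → 3 ≤ d →
      (∀ k ≤ d, k ∉ Z → 5 ≤ d + (if k = 0 ∨ k - 1 ∈ Z then 1 else 0) +
        if k = d ∨ k + 1 ∈ Z then 1 else 0) →
      d ≤ G.signlessLapEigenvalueCount (Set.Ico 0 ((Fintype.card V : ℝ) - 2)) + 1 := by
    intro Z hZ hd3 hk
    have := h.le_signlessLapEigenvalueCount_add_card ((offPath f d).card + (d - 3)) Z
      fun k hkd hkZ => by
        have e1 := hle (f k)
        have e2 := hk k hkd hkZ
        omega
    have e : (((offPath f d).card + (d - 3) : ℕ) : ℝ) + 2 = (Fintype.card V : ℝ) - 2 := by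
      rw [hn]
      push_cast [Nat.cast_sub hd3]
      ring
    rw [e] at this
    omega
  rcases Nat.lt_or_ge d 5 with hd | hd
  · interval_cases d
    · omega
    · omega
    -- For d = 2 the alternating vectors (-s, s, -s) give -4s² against a right side of at least
    -- -3s².
    · have := h.le_signlessLapEigenvalueCount_add
        ![addSuccDual 0, addSuccDual 1] ((Fintype.card V : ℝ) - 2) fun y hy => by
        have h0 : y 0 + y 1 = 0 := hy 0
        have h1 : y 1 + y 2 = 0 := hy 1
        have e0 : y 0 = - y 1 := by linarith
        have e2 : y 2 = - y 1 := by linarith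
        have d0 : ((G.offNeighbors f 2 (f 0)).card : ℝ) ≤ (offPath f 2).card := by
          exact_mod_cast hle (f 0)
        have d1 : ((G.offNeighbors f 2 (f 1)).card : ℝ) ≤ (offPath f 2).card := by
          exact_mod_cast hle (f 1)
        have d2 : ((G.offNeighbors f 2 (f 2)).card : ℝ) ≤ (offPath f 2).card := by
          exact_mod_cast hle (f 2)
        simp only [Finset.sum_range_succ, Finset.sum_range_zero, hn, e0, e2, Nat.reduceAdd]
        push_cast
        nlinarith [sq_nonneg (y 1), mul_nonneg (sub_nonneg.2 d0) (sq_nonneg (y 1)),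
          mul_nonneg (sub_nonneg.2 d1) (sq_nonneg (y 1)),
          mul_nonneg (sub_nonneg.2 d2) (sq_nonneg (y 1))]
      rw [Fintype.card_fin] at this
      omega
    -- The deletions here and for d = 4 leave only isolated path vertices.
    · refine key {1, 2} le_rfl le_rfl fun k hk hkZ => ?_
      interval_cases k <;> simp at hkZ ⊢
    · refine key {1, 3} le_rfl (by omega) fun k hk hkZ => ?_
      interval_cases k <;> simp at hkZ ⊢
  · exact key ∅ (by simp) (by omega) fun k hk _ => by omega

end IsGeodesicSeq

end SimpleGraph

theorem mainTheorem1 {V : Type*} [Fintype V] [DecidableEq V] (G : SimpleGraph V)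
    [DecidableRel G.Adj] (n d : ℕ) (hn : Fintype.card V = n) (hG : G.Connected)
    (hd : G.diam = d) :
    (d : ℤ) - 1 ≤ (G.signlessLapEigenvalueCount (Set.Ico 0 ((n : ℝ) - 2)) : ℤ) ∧
    (3 ≤ d → d + 3 ≤ n →
      (if d + 5 ≤ n then (d : ℤ) else (d : ℤ) - 1) ≤
        (G.signlessLapEigenvalueCount (Set.Ico 0 ((n : ℝ) - (d : ℝ) + 1)) : ℤ)) := by
  obtain ⟨f, hf⟩ := hG.exists_isGeodesicSeq_diam
  rw [hd] at hf
  have hcard := hf.card_offPath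
  refine ⟨?_, fun hd3 hdn => ?_⟩
  · have := hf.le_count_add_one_of_card
    rw [hn] at this
    omega
  · have e : (n : ℝ) - d + 1 = ((SimpleGraph.offPath f d).card : ℝ) + 2 := by
      rw [← hn, hcard]
      push_cast
      ring
    rw [e]
    split_ifs with h5
    · exact_mod_cast hf.le_signlessLapEigenvalueCount hG (by omega) (by omega)
    · have := hf.le_count_add_two hG (by omega) (by omega)
      omega
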